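/- Let $(X,d)$ be a non-empty proper geodesic Gromov hyperbolic metric space with Gromov boundary $\partial_GX$ (asymptotic classes $[\gamma]$ of geodesic rays $\gamma$) and Gromov compactification $X\sqcup\partial_GX$, and let $f\colon X\to X$ be non-expanding, i.e. $d(f(x),f(y))\le d(x,y)$ for all $x,y\in X$. For $\eta\in\partial_GX$ and $p\in X$ the dilation $\lambda_{\eta,p}$ is given by $\log\lambda_{\eta,p}=\liminf_{z\to\eta}\,\bigl(d(z,p)-d(f(z),p)\bigr)$. The point $\eta$ is a boundary regular fixed point of $f$ if $\lambda_{\eta,p}<+\infty$ for all $p\in X$ (this does not depend on $p$) and $f$ has geodesic limit $\eta$ at $\eta$, that is, $f(x_n)\to\eta$ for every sequence $(x_n)$ in $X$ which converges to $\eta$ and is contained in a geodesic region $\{x : d(x,\gamma)<R\}$, where $R>0$ and $\gamma$ is a geodesic ray with $[\gamma]=\eta$. The divergence rate of $f$ is $c(f)=\lim_{n\to\infty} d(x,f^n(x))/n$, which does not depend on $x\in X$. A backward orbit is a sequence $(w_n)_{n\ge0}$ with $f(w_{n+1})=w_n$ for all $n$; for $m\ge1$ its backward $m$-step is $\sigma_m(w_n)=\lim_{n\to\infty}d(w_n,w_{n+m})\in[0,\infty]$,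 and it has bounded step if $\sigma_1(w_n)<\infty$. 1. Assume that $f$ has diverging forward orbits, i.e. $d(p,f^n(x))\to\infty$ for all $x,p\in X$. Then $f$ has a unique Denjoy–Wolff point, i.e. there is a unique $\zeta\in\partial_GX$ with $f^n(x)\to\zeta$ for all $x\in X$; this $\zeta$ is a boundary regular fixed point of $f$, and $\log\lambda_{\zeta,p}\le -c(f)$ for all $p\in X$. 2. If $(w_n)$ is a backward orbit with bounded step which converges to a point $\eta\in\partial_GX$, then $\eta$ is a boundary regular fixed point of $f$, and $\log\lambda_{\eta,p}\le\inf_{m\ge1}\frac{\sigma_m(w_n)}{m}$ for all $p\in X$. -/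

import Mathlib

open Filter Topology Set
open scoped NNReal ENNReal

noncomputable section

namespace GromovDynamics

variable {X : Type*} [MetricSpace X]

/-- The Gromov product `(x|y)_p = (d(x,p) + d(y,p) - d(x,y)) / 2`. -/
def gromovProduct (p x y : X) : ℝ := (dist x p + dist y p - dist x y) / 2

/-- Gromov hyperbolicity (four-point condition). -/
def IsGromovHyperbolic (X : Type*) [MetricSpace X] : Prop :=
  ∃ δ : ℝ, 0 ≤ δ ∧ ∀ p x y z : X,
    min (gromovProduct p x y) (gromovProduct p y z) - δ ≤ gromovProduct p x z

/-- Any two points are joined by a geodesic segment, that is, an isometric embedding of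
`[0, d(x,y)]`. -/
def IsGeodesicSpace (X : Type*) [MetricSpace X] : Prop :=
  ∀ x y : X, ∃ γ : ℝ → X, γ 0 = x ∧ γ (dist x y) = y ∧
    ∀ s ∈ Icc 0 (dist x y), ∀ t ∈ Icc 0 (dist x y), dist (γ s) (γ t) = |s - t|

/-- Geodesic rays: isometric embeddings of `[0, ∞)`. -/
structure GeodesicRay (X : Type*) [MetricSpace X] where
  toFun : ℝ≥0 → X
  isometry : Isometry toFun

/-- Two rays are asymptotic if `t ↦ d(γ(t), σ(t))` is bounded. -/
def Asymptotic (γ σ : GeodesicRay X) : Prop :=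
  ∃ C : ℝ, ∀ t : ℝ≥0, dist (γ.1 t) (σ.1 t) ≤ C

instance asymptoticSetoid (X : Type*) [MetricSpace X] : Setoid (GeodesicRay X) where
  r := Asymptotic
  iseqv :=
    { refl := fun γ => ⟨0, fun t => by simp⟩
      symm := fun ⟨C, h⟩ => ⟨C, fun t => by rw [dist_comm]; exact h t⟩
      trans := fun ⟨C, h⟩ ⟨D, k⟩ =>
        ⟨C + D, fun t => (dist_triangle _ _ _).trans (add_le_add (h t) (k t))⟩ }

/-- The Gromov boundary: geodesic rays up to the relation of being asymptotic. -/
def GromovBoundary (X : Type*) [MetricSpace X] : Type _ := Quotient (asymptoticSetoid X)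

/-- The boundary point `[γ]`. -/
def GeodesicRay.endpoint (γ : GeodesicRay X) : GromovBoundary X :=
  Quotient.mk (asymptoticSetoid X) γ

/-- The filter on `X` of the sets containing `{x | (x|γ(t))_p ≥ N for all large t}` for some `N`. -/
def rayFilter (γ : GeodesicRay X) (p : X) : Filter X :=
  ⨅ N : ℝ, 𝓟 {x | ∀ᶠ t in atTop, N ≤ gromovProduct p x (γ.1 t)}

/-- A change of base point, or the passage to an asymptotic ray, does not change the filter. -/
theorem rayFilter_le_of_asymptotic {γ σ : GeodesicRay X} (h : Asymptotic γ σ) (p q : X) :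
    rayFilter γ p ≤ rayFilter σ q := by
  obtain ⟨C, hC⟩ := h
  refine le_iInf fun N => ?_
  refine iInf_le_of_le (N + dist p q + C) (principal_mono.2 ?_)
  intro x hx
  filter_upwards [hx] with t ht
  have h1 := hC t
  have h2 := dist_triangle x q p
  have h3 := dist_triangle (γ.1 t) (σ.1 t) q
  have h4 := dist_triangle x (γ.1 t) (σ.1 t)
  have h5 := dist_triangle (γ.1 t) q p
  have h6 := dist_comm p q
  unfold gromovProduct at ht ⊢
  have h7 := dist_triangle x (σ.1 t) (γ.1 t)
  have h8 := dist_comm (σ.1 t) (γ.1 t)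
  linarith

theorem rayFilter_eq_of_asymptotic {γ σ : GeodesicRay X} (h : Asymptotic γ σ) (p q : X) :
    rayFilter γ p = rayFilter σ q :=
  le_antisymm (rayFilter_le_of_asymptotic h p q)
    (rayFilter_le_of_asymptotic ((asymptoticSetoid X).iseqv.symm h) q p)

/-- The trace on `X` of the neighbourhood filter of a boundary point `ξ` in the Gromov
compactification `X ⊔ ∂_G X`: the filter of `z → ξ`, `z ∈ X`. -/
def GromovBoundary.approach (ξ : GromovBoundary X) : Filter X :=
  Quotient.lift (fun γ : GeodesicRay X => rayFilter γ (γ.1 0))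
    (fun γ σ h => rayFilter_eq_of_asymptotic h (γ.1 0) (σ.1 0)) ξ

/-- The base point in the Gromov products is irrelevant. -/
theorem approach_endpoint (γ : GeodesicRay X) (p : X) :
    γ.endpoint.approach = rayFilter γ p :=
  rayFilter_eq_of_asymptotic ((asymptoticSetoid X).iseqv.refl γ) (γ.1 0) p

theorem le_gromovProduct_ray (γ : GeodesicRay X) (p : X) {s t : ℝ≥0} (h : s ≤ t) :
    (s : ℝ) - dist p (γ.1 0) ≤ gromovProduct p (γ.1 s) (γ.1 t) := by
  have h1 := γ.2.dist_eq s t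
  have h2 := γ.2.dist_eq s 0
  have h3 := γ.2.dist_eq t 0
  have h' : (s : ℝ) ≤ t := by exact_mod_cast h
  rw [NNReal.dist_eq, abs_of_nonpos (by linarith)] at h1
  rw [NNReal.dist_eq, NNReal.coe_zero, sub_zero, abs_of_nonneg s.coe_nonneg] at h2
  rw [NNReal.dist_eq, NNReal.coe_zero, sub_zero, abs_of_nonneg t.coe_nonneg] at h3
  have h4 := dist_triangle (γ.1 s) p (γ.1 0)
  have h5 := dist_triangle (γ.1 t) p (γ.1 0)
  unfold gromovProduct
  linarith

/-- In a Gromov hyperbolic space, a sequence `(x_n)` in `X` converges to `[γ]` if and only if it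
goes to infinity in the Gromov sense and is equivalent to the sequence `(γ(n))`. -/
theorem tendsto_approach_endpoint_iff (hX : IsGromovHyperbolic X) (γ : GeodesicRay X) (p : X)
    (x : ℕ → X) :
    Tendsto x atTop γ.endpoint.approach ↔
      Tendsto (fun k : ℕ × ℕ => gromovProduct p (x k.1) (x k.2)) atTop atTop ∧
      Tendsto (fun n : ℕ => gromovProduct p (x n) (γ.1 n)) atTop atTop := by
  obtain ⟨δ, hδ, hX⟩ := hX
  have hsymm : ∀ a b : X, gromovProduct p a b = gromovProduct p b a := fun a b => by
    unfold gromovProduct; rw [dist_comm a b]; ring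
  rw [approach_endpoint γ p]
  simp only [rayFilter, tendsto_iInf, tendsto_principal, mem_ofPred_eq]
  constructor
  · intro h
    constructor
    · rw [tendsto_atTop]
      intro N
      rw [← prod_atTop_atTop_eq]
      filter_upwards [(h (N + δ)).prod_mk (h (N + δ))] with k hk
      obtain ⟨t, h1, h2⟩ := (hk.1.and hk.2).exists
      rw [hsymm] at h2
      have := hX p (x k.1) (γ.1 t) (x k.2)
      have := le_min h1 h2
      linarith
    · rw [tendsto_atTop]
      intro N
      filter_upwards [h (N + δ),
        tendsto_natCast_atTop_atTop.eventually_ge_atTop (N + δ + dist p (γ.1 0))] with n h1 h2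
      obtain ⟨t, h1, h3⟩ := (h1.and (eventually_ge_atTop (n : ℝ≥0))).exists
      have h4 := le_gromovProduct_ray γ p h3
      rw [NNReal.coe_natCast, hsymm] at h4
      have := hX p (x n) (γ.1 t) (γ.1 n)
      have := le_min h1 (show N + δ ≤ gromovProduct p (γ.1 t) (γ.1 n) by linarith)
      linarith
  · rintro ⟨-, h⟩ N
    filter_upwards [h.eventually_ge_atTop (N + δ),
      tendsto_natCast_atTop_atTop.eventually_ge_atTop (N + δ + dist p (γ.1 0))] with n h1 h2
    filter_upwards [eventually_ge_atTop (n : ℝ≥0)] with t h3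
    have h4 := le_gromovProduct_ray γ p h3
    rw [NNReal.coe_natCast] at h4
    have := hX p (x n) (γ.1 n) (γ.1 t)
    have := le_min h1 (show N + δ ≤ gromovProduct p (γ.1 n) (γ.1 t) by linarith)
    linarith

theorem tendsto_ray_approach (γ : GeodesicRay X) :
    Tendsto γ.1 atTop γ.endpoint.approach := by
  rw [approach_endpoint γ (γ.1 0)]
  simp only [rayFilter, tendsto_iInf, tendsto_principal, mem_ofPred_eq]
  intro N
  filter_upwards [eventually_ge_atTop N.toNNReal] with s hs
  filter_upwards [eventually_ge_atTop s] with t ht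
  have h := le_gromovProduct_ray γ (γ.1 0) ht
  have : N ≤ (s : ℝ) := Real.toNNReal_le_iff_le_coe.1 hs
  rw [dist_self] at h
  linarith

/-- Every boundary point is a limit of points of `X`. -/
instance approach_neBot (ξ : GromovBoundary X) : ξ.approach.NeBot := by
  induction ξ using Quotient.inductionOn with
  | h γ => exact (tendsto_ray_approach γ).neBot

/-- The geodesic region `A(γ, R)`, whose vertex is `[γ]`. -/
def geodesicRegion (γ : GeodesicRay X) (R : ℝ) : Set X :=
  {x | Metric.infDist x (range γ.1) < R}

/-- `f` has geodesic limit `ξ` at `η`. -/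
def HasGeodesicLimit (f : X → X) (η ξ : GromovBoundary X) : Prop :=
  ∀ x : ℕ → X, Tendsto x atTop η.approach →
    (∃ γ : GeodesicRay X, γ.endpoint = η ∧ ∃ R : ℝ, 0 < R ∧ ∀ n, x n ∈ geodesicRegion γ R) →
    Tendsto (fun n => f (x n)) atTop ξ.approach

/-- The dilation `λ_{η,p} ∈ [0, ∞]`, given by
`log λ_{η,p} = liminf_{z → η} (d(z,p) - d(f(z),p))`. -/
def dilation (f : X → X) (η : GromovBoundary X) (p : X) : ℝ≥0∞ :=
  EReal.exp (liminf (fun z => ((dist z p - dist (f z) p : ℝ) : EReal)) η.approach)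

/-- Boundary regular fixed points. -/
def IsBoundaryRegularFixedPoint (f : X → X) (η : GromovBoundary X) : Prop :=
  (∀ p : X, dilation f η p < ⊤) ∧ HasGeodesicLimit f η η

/-- All forward orbits diverge: no forward orbit has a bounded subsequence. -/
def HasDivergingForwardOrbits (f : X → X) : Prop :=
  ∀ x : X, Tendsto (fun n : ℕ => f^[n] x) atTop (Bornology.cobounded X)

/-- `ζ` is the Denjoy-Wolff point of `f`: all forward orbits converge to it. -/
def IsDenjoyWolffPoint (f : X → X) (ζ : GromovBoundary X) : Prop :=
  ∀ x : X, Tendsto (fun n : ℕ => f^[n] x) atTop ζ.approach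

/-- The divergence rate `c(f) = lim d(x, f^n(x)) / n`, for any `x`
(see `tendsto_divergenceRate`). -/
def divergenceRate [Nonempty X] (f : X → X) : ℝ :=
  limUnder atTop fun n : ℕ =>
    dist (Classical.arbitrary X) (f^[n] (Classical.arbitrary X)) / n

theorem tendsto_divergenceRate [Nonempty X] {f : X → X} (hf : LipschitzWith 1 f) (x : X) :
    Tendsto (fun n : ℕ => dist x (f^[n] x) / n) atTop (𝓝 (divergenceRate f)) := by
  have hn : ∀ (n : ℕ) (a b : X), dist (f^[n] a) (f^[n] b) ≤ dist a b := fun n a b => by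
    simpa using (hf.iterate n).dist_le_mul a b
  set o : X := Classical.arbitrary X
  have hsub : Subadditive fun n : ℕ => dist o (f^[n] o) := by
    intro m n
    have h1 := dist_triangle o (f^[m] o) (f^[m + n] o)
    have h2 := hn m o (f^[n] o)
    rw [← Function.iterate_add_apply] at h2
    show dist o (f^[m + n] o) ≤ dist o (f^[m] o) + dist o (f^[n] o)
    linarith
  have hlim : Tendsto (fun n : ℕ => dist o (f^[n] o) / n) atTop (𝓝 (divergenceRate f)) :=
    tendsto_nhds_limUnder ⟨_, hsub.tendsto_lim ⟨0, by rintro _ ⟨n, rfl⟩; positivity⟩⟩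
  have h0 : Tendsto (fun n : ℕ => 2 * dist x o / n) atTop (𝓝 0) :=
    tendsto_const_div_atTop_nhds_zero_nat _
  have hdiff : Tendsto (fun n : ℕ => dist x (f^[n] x) / n - dist o (f^[n] o) / n) atTop (𝓝 0) := by
    refine squeeze_zero_norm (fun n => ?_) h0
    rw [← sub_div, Real.norm_eq_abs, abs_div, Nat.abs_cast]
    gcongr
    have h1 := hn n x o
    have h2 := dist_triangle4 x o (f^[n] o) (f^[n] x)
    have h3 := dist_triangle4 o x (f^[n] x) (f^[n] o)
    rw [dist_comm (f^[n] o) (f^[n] x)] at h2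
    rw [dist_comm o x] at h3
    rw [abs_le]
    constructor <;> linarith
  simpa using hdiff.add hlim

/-- Backward orbits: `f(w_{n+1}) = w_n`. -/
def IsBackwardOrbit (f : X → X) (w : ℕ → X) : Prop := ∀ n, f (w (n + 1)) = w n

/-- The backward `m`-step `σ_m(w) = lim d(w_n, w_{n+m}) ∈ [0, ∞]`
(see `tendsto_backwardStep`). -/
def backwardStep (w : ℕ → X) (m : ℕ) : ℝ≥0∞ :=
  limUnder atTop fun n : ℕ => edist (w n) (w (n + m))

theorem tendsto_backwardStep {f : X → X} (hf : LipschitzWith 1 f) {w : ℕ → X}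
    (hw : IsBackwardOrbit f w) (m : ℕ) :
    Tendsto (fun n : ℕ => edist (w n) (w (n + m))) atTop (𝓝 (backwardStep w m)) := by
  refine tendsto_nhds_limUnder ⟨_, tendsto_atTop_iSup (monotone_nat_of_le_succ fun n => ?_)⟩
  have h := hf (w (n + 1)) (w (n + 1 + m))
  rw [hw n, show n + 1 + m = n + m + 1 by omega, hw (n + m)] at h
  simpa [show n + 1 + m = n + m + 1 by omega] using h

/-- The backward orbit `w` has bounded step: `σ_1(w) < ∞`. -/
def HasBoundedStep (w : ℕ → X) : Prop := backwardStep w 1 < ⊤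

end GromovDynamics

end

open Filter Topology Set
open scoped NNReal ENNReal

namespace GromovDynamics

/-! ### Convergence to boundary points of the Gromov compactification. -/

section Convergence

variable {X : Type*} [MetricSpace X]

/-! Diverging orbits: if n is a record time of d(f^n x, x), non-expansion gives (f^k x | f^n x)_x ≥
d(f^k x, x)/2 for k ≤ n. Comparing two large times with a common later record time shows that the
orbit converges to infinity in the Gromov sense, so properness gives it a boundary limit; other
orbits stay at bounded distance (`exists_isDenjoyWolffPoint`). Geodesic limits: a sequence z_k with
z_k, f(z_k) → η and d(z_k,p) - d(f(z_k),p) bounded above suffices (`hasGeodesicLimit_of_dist_le`).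
Forward and bounded-step backward orbits are such sequences. Dilations: the liminf at η is at most
the liminf along such an orbit, and an eventual lower bound q on the increments telescopes, giving q
≤ -c(f), respectively mq ≤ σ_m. -/

theorem gromovProduct_comm (p x y : X) : gromovProduct p x y = gromovProduct p y x := by
  unfold gromovProduct
  rw [dist_comm x y]
  ring

theorem gromovProduct_le_dist (p x y : X) : gromovProduct p x y ≤ dist x p := by
  unfold gromovProduct
  have := dist_triangle y x p
  rw [dist_comm y x] at this
  linarith

theorem gromovProduct_sub_dist_le (p x y z : X) :
    gromovProduct p x z - dist x y ≤ gromovProduct p y z := by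
  unfold gromovProduct
  have h1 := dist_triangle x y p
  have h2 := dist_triangle y x z
  rw [dist_comm y x] at h2
  linarith

theorem exists_endpoint_eq (ξ : GromovBoundary X) : ∃ γ : GeodesicRay X, γ.endpoint = ξ :=
  Quotient.exists_rep ξ

theorem GeodesicRay.dist_zero (γ : GeodesicRay X) (t : ℝ≥0) : dist (γ.1 t) (γ.1 0) = t := by
  rw [γ.2.dist_eq, NNReal.dist_eq, NNReal.coe_zero, sub_zero, abs_of_nonneg t.coe_nonneg]

theorem tendsto_endpoint_approach_iff {ι : Type*} {l : Filter ι} {u : ι → X}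
    (γ : GeodesicRay X) (p : X) :
    Tendsto u l γ.endpoint.approach ↔
      ∀ N : ℝ, ∀ᶠ i in l, ∀ᶠ t in atTop, N ≤ gromovProduct p (u i) (γ.1 t) := by
  rw [approach_endpoint γ p]
  simp only [rayFilter, tendsto_iInf, tendsto_principal, mem_ofPred_eq]

/-- A family at bounded distance from a family converging to a boundary point has the same
limit. -/
theorem tendsto_approach_of_dist_le {ι : Type*} {l : Filter ι} {u v : ι → X}
    {ξ : GromovBoundary X} (hu : Tendsto u l ξ.approach) {C : ℝ}
    (h : ∀ᶠ i in l, dist (u i) (v i) ≤ C) : Tendsto v l ξ.approach := by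
  obtain ⟨γ, rfl⟩ := exists_endpoint_eq ξ
  rw [tendsto_endpoint_approach_iff γ (γ.1 0)] at hu ⊢
  intro N
  filter_upwards [hu (N + C), h] with i hi hC
  filter_upwards [hi] with t ht
  have := gromovProduct_sub_dist_le (γ.1 0) (u i) (v i) (γ.1 t)
  linarith

/-- A family whose Gromov products with a sequence converging to a boundary point are large
converges to the same point. -/
theorem tendsto_approach_of_gromovProduct (hX : IsGromovHyperbolic X) {ι : Type*} {l : Filter ι}
    {u : ι → X} {z : ℕ → X} {ξ : GromovBoundary X} (hz : Tendsto z atTop ξ.approach) (p : X)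
    (h : ∀ N : ℝ, ∀ᶠ i in l, ∃ᶠ k in atTop, N ≤ gromovProduct p (u i) (z k)) :
    Tendsto u l ξ.approach := by
  obtain ⟨δ, hδ, hX⟩ := hX
  obtain ⟨γ, rfl⟩ := exists_endpoint_eq ξ
  rw [tendsto_endpoint_approach_iff γ p] at hz ⊢
  intro N
  filter_upwards [h (N + δ)] with i hi
  obtain ⟨k, h1, h2⟩ := (hi.and_eventually (hz (N + δ))).exists
  filter_upwards [h2] with t ht
  have := hX p (u i) (z k) (γ.1 t)
  have := le_min h1 ht
  linarith

theorem tendsto_dist_of_tendsto_approach {ι : Type*} {l : Filter ι} {u : ι → X}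
    {ξ : GromovBoundary X} (hu : Tendsto u l ξ.approach) (p : X) :
    Tendsto (fun i => dist (u i) p) l atTop := by
  obtain ⟨γ, rfl⟩ := exists_endpoint_eq ξ
  rw [tendsto_endpoint_approach_iff γ p] at hu
  rw [tendsto_atTop]
  intro N
  filter_upwards [hu N] with i hi
  obtain ⟨t, ht⟩ := hi.exists
  exact ht.trans (gromovProduct_le_dist p (u i) (γ.1 t))

/-- The Gromov compactification is separated at the boundary. -/
theorem eq_of_tendsto_approach (hX : IsGromovHyperbolic X) {ι : Type*} {l : Filter ι} [l.NeBot]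
    {u : ι → X} {ξ η : GromovBoundary X} (hξ : Tendsto u l ξ.approach)
    (hη : Tendsto u l η.approach) : ξ = η := by
  obtain ⟨δ, hδ, hX⟩ := hX
  obtain ⟨γ, rfl⟩ := exists_endpoint_eq ξ
  obtain ⟨σ, rfl⟩ := exists_endpoint_eq η
  set p := γ.1 0
  set D := dist p (σ.1 0)
  have hD : 0 ≤ D := dist_nonneg
  rw [tendsto_endpoint_approach_iff γ p] at hξ
  rw [tendsto_endpoint_approach_iff σ p] at hη
  refine Quotient.sound ⟨3 * D + 6 * δ, fun t => ?_⟩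
  -- The ray parameter t also serves as the level of the Gromov products: (γ(t)|σ(t))_p ≥ t - D - 2δ
  -- follows by passing through u_i, while both points are at distance about t from p.
  obtain ⟨i, h1, h2⟩ := ((hξ t).and (hη t)).exists
  obtain ⟨s, ⟨h1, h2⟩, hs⟩ := ((h1.and h2).and (eventually_ge_atTop t)).exists
  have h3 := le_gromovProduct_ray γ p hs
  have h4 : (t : ℝ) - D ≤ _ := le_gromovProduct_ray σ p hs
  rw [dist_self, sub_zero] at h3
  rw [gromovProduct_comm] at h1 h4
  have h5 := hX p (γ.1 t) (γ.1 s) (u i)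
  have h6 := le_min h3 h1
  have h7 := hX p (u i) (σ.1 s) (σ.1 t)
  have h8 := le_min (show (t : ℝ) - D ≤ gromovProduct p (u i) (σ.1 s) by linarith) h4
  have h9 := hX p (γ.1 t) (u i) (σ.1 t)
  have h10 := le_min (show (t : ℝ) - D - δ ≤ gromovProduct p (γ.1 t) (u i) by linarith)
    (show (t : ℝ) - D - δ ≤ gromovProduct p (u i) (σ.1 t) by linarith)
  have h11 : (t : ℝ) - D - 2 * δ ≤ gromovProduct p (γ.1 t) (σ.1 t) := by linarith
  have h12 := γ.dist_zero t
  have h13 := σ.dist_zero t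
  have h14 := dist_triangle (σ.1 t) (σ.1 0) p
  rw [dist_comm (σ.1 0) p] at h14
  unfold gromovProduct at h11
  change dist (γ.1 t) p = t at h12
  linarith

/-- In a proper geodesic hyperbolic space, every sequence converging to infinity in the Gromov
sense converges to the endpoint of a geodesic ray. -/
theorem exists_tendsto_approach [ProperSpace X] (hgeo : IsGeodesicSpace X)
    (hX : IsGromovHyperbolic X) {x : ℕ → X} {p : X}
    (hx : ∀ N : ℝ, ∃ n₀, ∀ m ≥ n₀, ∀ n ≥ n₀, N ≤ gromovProduct p (x m) (x n)) :
    ∃ ζ : GromovBoundary X, Tendsto x atTop ζ.approach := by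
  obtain ⟨δ, hδ, hX⟩ := hX
  choose g hg0 hg1 hg using fun n => hgeo p (x n)
  have hdist : ∀ N : ℝ, ∀ᶠ n in atTop, N ≤ dist p (x n) := by
    intro N
    obtain ⟨n₀, h⟩ := hx N
    filter_upwards [eventually_ge_atTop n₀] with n hn
    rw [dist_comm]
    exact (h n hn n hn).trans (gromovProduct_le_dist _ _ _)
  -- Limits of the segments from p to x_n along one ultrafilter exist for all t at once and form the
  -- ray, without a diagonal subsequence.
  set U : Ultrafilter ℕ := Ultrafilter.of atTop
  have hU : (U : Filter ℕ) ≤ atTop := Ultrafilter.of_le _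
  have hlim : ∀ t : ℝ≥0, ∃ y : X, Tendsto (fun n => g n t) U (𝓝 y) := by
    intro t
    have hmem : ∀ᶠ n in (U : Filter ℕ), g n t ∈ Metric.closedBall p t := by
      filter_upwards [hU (hdist t)] with n hn
      have hn : (t : ℝ) ≤ dist p (x n) := hn
      have := hg n t ⟨t.2, hn⟩ 0 ⟨le_rfl, dist_nonneg⟩
      rw [hg0, sub_zero, abs_of_nonneg t.coe_nonneg] at this
      exact this.le
    obtain ⟨y, -, hy⟩ := (isCompact_closedBall p (t : ℝ)).ultrafilter_le_nhds
      (U.map fun n => g n t) (le_principal_iff.2 hmem)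
    exact ⟨y, hy⟩
  choose r hr using hlim
  have hiso : Isometry r := by
    refine Isometry.of_dist_eq fun s t => ?_
    refine tendsto_nhds_unique ((hr s).dist (hr t)) (tendsto_const_nhds.congr' ?_)
    filter_upwards [hU (hdist s), hU (hdist t)] with n hs ht
    rw [hg n s ⟨s.2, hs⟩ t ⟨t.2, ht⟩]
    rfl
  set γ : GeodesicRay X := ⟨r, hiso⟩
  refine ⟨γ.endpoint, ?_⟩
  rw [tendsto_endpoint_approach_iff γ p]
  intro N
  obtain ⟨n₀, h⟩ := hx (N + δ)
  filter_upwards [eventually_ge_atTop n₀] with n hn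
  -- The 1 absorbs the distance from r(t) to an approximating point on the segment to x_m.
  filter_upwards [eventually_ge_atTop (N + δ + 1).toNNReal] with t ht
  have ht : N + δ + 1 ≤ (t : ℝ) := Real.toNNReal_le_iff_le_coe.1 ht
  obtain ⟨m, ⟨hm1, hm2⟩, hm3⟩ := (((hr t).eventually (Metric.ball_mem_nhds (r t) one_pos)).and
    (hU (hdist t)) |>.and (hU (eventually_ge_atTop n₀))).exists
  have hm2 : (t : ℝ) ≤ dist p (x m) := hm2
  have hm1 : dist (g m t) (r t) < 1 := hm1
  have h0 := hg m t ⟨t.2, hm2⟩ 0 ⟨le_rfl, dist_nonneg⟩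
  rw [hg0, sub_zero, abs_of_nonneg t.coe_nonneg] at h0
  have h1 := hg m t ⟨t.2, hm2⟩ (dist p (x m)) ⟨dist_nonneg, le_rfl⟩
  rw [hg1, abs_of_nonpos (by linarith)] at h1
  have h2 : gromovProduct p (g m t) (x m) = t := by
    unfold gromovProduct
    rw [h0, h1, dist_comm (x m) p]
    ring
  have h3 := gromovProduct_sub_dist_le p (g m t) (r t) (x m)
  rw [gromovProduct_comm p (r t)] at h3
  have h4 := hX p (x n) (x m) (r t)
  have h5 := le_min (h n hn m hm3) (show N + δ ≤ gromovProduct p (x m) (r t) by linarith)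
  change N ≤ gromovProduct p (x n) (r t)
  linarith

end Convergence

/-! ### Geodesic limits, dilations and forward orbits. -/

section Dynamics

variable {X : Type*} [MetricSpace X] {f : X → X}

/-- If `z_k` and `f(z_k)` converge to `η` and `d(z_k,p) - d(f(z_k),p)` is bounded above, then `f`
has geodesic limit `η` at `η`. -/
theorem hasGeodesicLimit_of_dist_le (hX : IsGromovHyperbolic X) (hf : LipschitzWith 1 f)
    {η : GromovBoundary X} {z : ℕ → X} (hz : Tendsto z atTop η.approach)
    (hfz : Tendsto (fun k => f (z k)) atTop η.approach)
    (hA : ∀ p : X, ∃ A : ℝ, ∀ k, dist (z k) p ≤ dist (f (z k)) p + A) :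
    HasGeodesicLimit f η η := by
  rintro x hx ⟨γ, rfl, R, hR, hreg⟩
  set p := γ.1 0
  obtain ⟨A, hA⟩ := hA p
  refine tendsto_approach_of_gromovProduct hX hfz p fun N => ?_
  obtain ⟨δ, hδ, hX⟩ := hX
  rw [tendsto_endpoint_approach_iff γ p] at hz
  filter_upwards [(tendsto_dist_of_tendsto_approach hx p).eventually_ge_atTop
    (2 * N + 2 * R + 2 * δ + A)] with n hn
  obtain ⟨_, ⟨t, rfl⟩, ht⟩ := (Metric.infDist_lt_iff (range_nonempty γ.1)).1 (hreg n)
  refine Eventually.frequently ?_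
  filter_upwards [hz t] with k hk
  obtain ⟨s, h1, hs⟩ := (hk.and (eventually_ge_atTop t)).exists
  have h2 := le_gromovProduct_ray γ p hs
  rw [dist_self, sub_zero] at h2
  rw [gromovProduct_comm] at h1
  have h3 := hX p (γ.1 t) (γ.1 s) (z k)
  have h4 := le_min h2 h1
  have h5 : (t : ℝ) - δ ≤ gromovProduct p (γ.1 t) (z k) := by linarith
  have h6 : dist (f (x n)) (f (z k)) ≤ dist (x n) (z k) := by simpa using hf.dist_le_mul (x n) (z k)
  have h7 := dist_triangle (x n) (γ.1 t) (z k)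
  have h8 := dist_triangle (x n) (γ.1 t) p
  have h9 : dist (γ.1 t) p = t := γ.dist_zero t
  have h10 := hA k
  have h11 : 0 ≤ dist (f (x n)) p := dist_nonneg
  unfold gromovProduct at h5 ⊢
  linarith

/-- The dilation is bounded by the growth along any sequence converging to the boundary point. -/
theorem log_dilation_le {η : GromovBoundary X} {z : ℕ → X} (hz : Tendsto z atTop η.approach)
    {p : X} {c : ℝ} (h : ∀ q : ℝ, (∀ᶠ k in atTop, q ≤ dist (z k) p - dist (f (z k)) p) → q ≤ c) :
    ENNReal.log (dilation f η p) ≤ (c : EReal) := by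
  rw [dilation, EReal.log_exp]
  refine (liminf_le_liminf_of_le hz).trans (le_of_not_gt fun hlt => ?_)
  obtain ⟨q, hq, hlt⟩ := EReal.lt_iff_exists_real_btwn.1 hlt
  have hev := eventually_map.1 (eventually_lt_of_lt_liminf hlt)
  exact absurd (h q (hev.mono fun k hk => (EReal.coe_lt_coe_iff.1 hk).le))
    (not_le.2 (EReal.coe_lt_coe_iff.1 hq))

theorem dilation_lt_top_of_log_le {η : GromovBoundary X} {p : X} {c : ℝ}
    (h : ENNReal.log (dilation f η p) ≤ (c : EReal)) : dilation f η p < ⊤ := by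
  rw [lt_top_iff_ne_top]
  intro htop
  rw [htop, ENNReal.log_top] at h
  exact absurd h (not_le.2 (EReal.coe_lt_top c))

theorem mul_le_sub_of_le_sub {a : ℕ → ℝ} {q : ℝ} {n₀ : ℕ}
    (h : ∀ n ≥ n₀, q ≤ a (n + 1) - a n) {n : ℕ} (hn : n₀ ≤ n) (m : ℕ) :
    m * q ≤ a (n + m) - a n := by
  induction m with
  | zero => simp
  | succ m ih =>
    have := h (n + m) (by omega)
    rw [← add_assoc]
    push_cast
    linarith

theorem dist_iterate_le (hf : LipschitzWith 1 f) (n : ℕ) (x y : X) :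
    dist (f^[n] x) (f^[n] y) ≤ dist x y := by
  simpa using (hf.iterate n).dist_le_mul x y

theorem tendsto_dist_iterate (h : HasDivergingForwardOrbits f) (x p : X) :
    Tendsto (fun n : ℕ => dist (f^[n] x) p) atTop atTop :=
  (Metric.tendsto_dist_right_cobounded_atTop p).comp (h x)

/-- Non-expansion and the record property give d(f^k x, f^n x) ≤ d(x, f^(n-k) x) ≤ d(f^n x, x). -/
theorem gromovProduct_iterate_ge (hf : LipschitzWith 1 f) (x : X) {n k : ℕ} (hk : k ≤ n)
    (hmax : ∀ m ≤ n, dist (f^[m] x) x ≤ dist (f^[n] x) x) :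
    dist (f^[k] x) x / 2 ≤ gromovProduct x (f^[k] x) (f^[n] x) := by
  have h1 := hmax (n - k) (by omega)
  have h2 := dist_iterate_le hf k x (f^[n - k] x)
  rw [← Function.iterate_add_apply, Nat.add_sub_cancel' hk, dist_comm x] at h2
  unfold gromovProduct
  linarith

theorem exists_ge_forall_dist_iterate_le (h : HasDivergingForwardOrbits f) (x : X) (k : ℕ) :
    ∃ n ≥ k, ∀ m ≤ n, dist (f^[m] x) x ≤ dist (f^[n] x) x := by
  obtain ⟨n, hn, hlt⟩ := Filter.high_scores (tendsto_dist_iterate h x x) k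
  exact ⟨n, hn, fun m hm => hm.eq_or_lt.elim (fun e => by rw [e]) fun hm => (hlt m hm).le⟩

/-- Diverging forward orbits converge to infinity in the Gromov sense. -/
theorem exists_le_gromovProduct_iterate (hX : IsGromovHyperbolic X) (hf : LipschitzWith 1 f)
    (h : HasDivergingForwardOrbits f) (x : X) (N : ℝ) :
    ∃ n₀, ∀ m ≥ n₀, ∀ n ≥ n₀, N ≤ gromovProduct x (f^[m] x) (f^[n] x) := by
  obtain ⟨δ, hδ, hX⟩ := hX
  obtain ⟨n₀, hn₀⟩ := eventually_atTop.1
    ((tendsto_dist_iterate h x x).eventually_ge_atTop (2 * (N + δ)))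
  refine ⟨n₀, fun m hm n hn => ?_⟩
  obtain ⟨j, hj, hmax⟩ := exists_ge_forall_dist_iterate_le h x (max m n)
  have h1 := gromovProduct_iterate_ge hf x ((le_max_left m n).trans hj) hmax
  have h2 := gromovProduct_iterate_ge hf x ((le_max_right m n).trans hj) hmax
  rw [gromovProduct_comm] at h2
  have h3 := hX x (f^[m] x) (f^[j] x) (f^[n] x)
  have h4 := le_min (show N + δ ≤ gromovProduct x (f^[m] x) (f^[j] x) by linarith [hn₀ m hm])
    (show N + δ ≤ gromovProduct x (f^[j] x) (f^[n] x) by linarith [hn₀ n hn])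
  linarith

theorem exists_isDenjoyWolffPoint [ProperSpace X] [Nonempty X] (hgeo : IsGeodesicSpace X)
    (hX : IsGromovHyperbolic X) (hf : LipschitzWith 1 f) (h : HasDivergingForwardOrbits f) :
    ∃ ζ : GromovBoundary X, IsDenjoyWolffPoint f ζ := by
  obtain ⟨x⟩ := ‹Nonempty X›
  obtain ⟨ζ, hζ⟩ := exists_tendsto_approach hgeo hX (exists_le_gromovProduct_iterate hX hf h x)
  exact ⟨ζ, fun y => tendsto_approach_of_dist_le hζ
    (Eventually.of_forall fun n => dist_iterate_le hf n x y)⟩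

theorem IsDenjoyWolffPoint.hasGeodesicLimit [Nonempty X] (hX : IsGromovHyperbolic X)
    (hf : LipschitzWith 1 f) {ζ : GromovBoundary X} (hζ : IsDenjoyWolffPoint f ζ) :
    HasGeodesicLimit f ζ ζ := by
  obtain ⟨x⟩ := ‹Nonempty X›
  have hcomm : ∀ n, f (f^[n] x) = f^[n] (f x) := fun n => by
    rw [← Function.iterate_succ_apply' f, Function.iterate_succ_apply]
  refine hasGeodesicLimit_of_dist_le hX hf (hζ x) (by simpa only [hcomm] using hζ (f x))
    fun p => ⟨dist x (f x), fun k => ?_⟩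
  rw [hcomm]
  linarith [dist_iterate_le hf k x (f x), dist_triangle (f^[k] x) (f^[k] (f x)) p]

theorem IsDenjoyWolffPoint.log_dilation_le [Nonempty X] (hf : LipschitzWith 1 f)
    {ζ : GromovBoundary X} (hζ : IsDenjoyWolffPoint f ζ) (p : X) :
    ENNReal.log (dilation f ζ p) ≤ ((-divergenceRate f : ℝ) : EReal) := by
  refine GromovDynamics.log_dilation_le (hζ p) fun q hq => ?_
  obtain ⟨n₀, hn₀⟩ := eventually_atTop.1 hq
  have hlim : Tendsto (fun n : ℕ => dist p (f^[n + n₀] p) / (n + n₀ : ℕ)) atTop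
      (𝓝 (divergenceRate f)) := (tendsto_add_atTop_iff_nat n₀).2 (tendsto_divergenceRate hf p)
  -- Telescoping gives d(p, f^(n+n₀) p) ≤ d(p, f^n₀ p) - nq, and -nq = n₀q - (n+n₀)q.
  have hbound : Tendsto (fun n : ℕ => (dist p (f^[n₀] p) + n₀ * q) / (n + n₀ : ℕ) - q) atTop
      (𝓝 (0 - q)) :=
    ((tendsto_add_atTop_iff_nat n₀).2 (tendsto_const_div_atTop_nhds_zero_nat _)).sub_const q
  have hle : divergenceRate f ≤ 0 - q := by
    refine le_of_tendsto_of_tendsto hlim hbound ?_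
    filter_upwards [eventually_ge_atTop 1] with n hn
    have h1 := mul_le_sub_of_le_sub (a := fun n => -dist (f^[n] p) p) (q := q) (n₀ := n₀)
      (fun n hn => by
        have := hn₀ n hn
        rw [Function.iterate_succ_apply']
        linarith) le_rfl n
    have hpos : (0 : ℝ) < (n + n₀ : ℕ) := by exact_mod_cast (by omega : 0 < n + n₀)
    rw [div_sub' hpos.ne', div_le_div_iff_of_pos_right hpos, dist_comm p, dist_comm p,
      add_comm n n₀]
    push_cast
    linarith
  linarith

/-! ### Backward orbits. -/

theorem edist_le_backwardStep (hf : LipschitzWith 1 f) {w : ℕ → X} (hw : IsBackwardOrbit f w)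
    (m n : ℕ) : edist (w n) (w (n + m)) ≤ backwardStep w m := by
  refine Monotone.ge_of_tendsto (monotone_nat_of_le_succ fun n => ?_)
    (tendsto_backwardStep hf hw m) n
  have h := hf (w (n + 1)) (w (n + 1 + m))
  rw [hw n, show n + 1 + m = n + m + 1 by omega, hw (n + m)] at h
  simpa [show n + 1 + m = n + m + 1 by omega] using h

theorem dist_le_backwardStep_toReal (hf : LipschitzWith 1 f) {w : ℕ → X}
    (hw : IsBackwardOrbit f w) {m : ℕ} (hm : backwardStep w m ≠ ⊤) (n : ℕ) :
    dist (w n) (w (n + m)) ≤ (backwardStep w m).toReal := by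
  rw [dist_edist]
  exact ENNReal.toReal_mono hm (edist_le_backwardStep hf hw m n)

theorem IsBackwardOrbit.hasGeodesicLimit (hX : IsGromovHyperbolic X) (hf : LipschitzWith 1 f)
    {w : ℕ → X} (hw : IsBackwardOrbit f w) (hstep : HasBoundedStep w) {η : GromovBoundary X}
    (hη : Tendsto w atTop η.approach) : HasGeodesicLimit f η η := by
  -- The shift z_k = w_(k+1) makes f(z_k) = w_k.
  refine hasGeodesicLimit_of_dist_le hX hf ((tendsto_add_atTop_iff_nat 1).2 hη)
    (by simpa only [hw _] using hη) fun p => ⟨(backwardStep w 1).toReal, fun k => ?_⟩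
  rw [hw k]
  have h1 := dist_le_backwardStep_toReal hf hw hstep.ne k
  have h2 := dist_triangle (w (k + 1)) (w k) p
  rw [dist_comm (w (k + 1)) (w k)] at h2
  linarith

theorem IsBackwardOrbit.log_dilation_le (hf : LipschitzWith 1 f) {w : ℕ → X}
    (hw : IsBackwardOrbit f w) {η : GromovBoundary X} (hη : Tendsto w atTop η.approach) (p : X)
    {m : ℕ} (hm0 : 0 < m) (hm : backwardStep w m ≠ ⊤) :
    ENNReal.log (dilation f η p) ≤ (((backwardStep w m).toReal / m : ℝ) : EReal) := by
  refine GromovDynamics.log_dilation_le ((tendsto_add_atTop_iff_nat 1).2 hη) fun q hq => ?_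
  obtain ⟨n₀, hn₀⟩ := eventually_atTop.1 hq
  have h1 := mul_le_sub_of_le_sub (a := fun n => dist (w n) p) (q := q) (n₀ := n₀)
    (fun n hn => by simpa only [hw n] using hn₀ n hn) le_rfl m
  have h2 := dist_le_backwardStep_toReal hf hw hm n₀
  have h3 := dist_triangle (w (n₀ + m)) (w n₀) p
  rw [dist_comm (w (n₀ + m)) (w n₀)] at h3
  rw [le_div_iff₀ (by exact_mod_cast hm0)]
  linarith

theorem IsBackwardOrbit.log_dilation_le_backwardStep_div (hf : LipschitzWith 1 f) {w : ℕ → X}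
    (hw : IsBackwardOrbit f w) {η : GromovBoundary X} (hη : Tendsto w atTop η.approach) (p : X)
    {m : ℕ} (hm0 : 0 < m) :
    ENNReal.log (dilation f η p) ≤ ((backwardStep w m / (m : ℝ≥0∞) : ℝ≥0∞) : EReal) := by
  by_cases hm : backwardStep w m = ⊤
  · simp [hm, ENNReal.top_div_of_ne_top]
  · have h := hw.log_dilation_le hf hη p hm0 hm
    rwa [← ENNReal.toReal_natCast, ← ENNReal.toReal_div, EReal.coe_ennreal_toReal] at h
    exact (ENNReal.div_lt_top hm (by exact_mod_cast hm0.ne')).ne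

end Dynamics

end GromovDynamics

theorem mainTheorem10 {X : Type*} [MetricSpace X] [ProperSpace X] [Nonempty X]
    (hgeo : GromovDynamics.IsGeodesicSpace X) (hhyp : GromovDynamics.IsGromovHyperbolic X)
    (f : X → X) (hf : LipschitzWith 1 f) :
    (GromovDynamics.HasDivergingForwardOrbits f →
      (∃! ζ : GromovDynamics.GromovBoundary X, GromovDynamics.IsDenjoyWolffPoint f ζ) ∧
      ∀ ζ : GromovDynamics.GromovBoundary X, GromovDynamics.IsDenjoyWolffPoint f ζ →
        GromovDynamics.IsBoundaryRegularFixedPoint f ζ ∧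
        ∀ p : X, ENNReal.log (GromovDynamics.dilation f ζ p) ≤
          ((-GromovDynamics.divergenceRate f : ℝ) : EReal)) ∧
    (∀ (w : ℕ → X) (η : GromovDynamics.GromovBoundary X),
      GromovDynamics.IsBackwardOrbit f w → GromovDynamics.HasBoundedStep w →
      Tendsto w atTop η.approach →
        GromovDynamics.IsBoundaryRegularFixedPoint f η ∧
        ∀ p : X, ENNReal.log (GromovDynamics.dilation f η p) ≤
          ((⨅ m : ℕ+, GromovDynamics.backwardStep w m / ((m : ℕ) : ℝ≥0∞) : ℝ≥0∞) : EReal)) := by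
  have hlog : ∀ {η : GromovDynamics.GromovBoundary X} {c : X → ℝ},
      (∀ p, ENNReal.log (GromovDynamics.dilation f η p) ≤ (c p : EReal)) →
      GromovDynamics.HasGeodesicLimit f η η → GromovDynamics.IsBoundaryRegularFixedPoint f η :=
    fun h hlim => ⟨fun p => GromovDynamics.dilation_lt_top_of_log_le (h p), hlim⟩
  refine ⟨fun hdiv => ⟨?_, fun ζ hζ => ?_⟩, fun w η hw hstep hη => ?_⟩
  · obtain ⟨ζ, hζ⟩ := GromovDynamics.exists_isDenjoyWolffPoint hgeo hhyp hf hdiv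
    have x : X := Classical.arbitrary X
    exact ⟨ζ, hζ, fun ξ hξ => GromovDynamics.eq_of_tendsto_approach hhyp (hξ x) (hζ x)⟩
  · exact ⟨hlog (hζ.log_dilation_le hf) (hζ.hasGeodesicLimit hhyp hf), hζ.log_dilation_le hf⟩
  · refine ⟨hlog (fun p => hw.log_dilation_le hf hη p one_pos hstep.ne)
      (hw.hasGeodesicLimit hhyp hf hstep hη), fun p => ?_⟩
    -- The infimum is taken in `ℝ≥0∞`: a nonpositive logarithm is trivially below it, and a
    -- nonnegative one is moved to `ℝ≥0∞` and compared termwise.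
    rcases le_total (ENNReal.log (GromovDynamics.dilation f η p)) 0 with h0 | h0
    · exact h0.trans (EReal.coe_ennreal_nonneg _)
    · rw [← EReal.coe_toENNReal h0, EReal.coe_ennreal_le_coe_ennreal_iff]
      refine le_iInf fun m => ?_
      rw [← EReal.coe_ennreal_le_coe_ennreal_iff, EReal.coe_toENNReal h0]
      exact hw.log_dilation_le_backwardStep_div hf hη p m.pos
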